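/- Let $F$ be a Hausdorff locally convex real topological vector space, let $M$ be a finite-dimensional, $\sigma$-compact (Hausdorff) smooth manifold with corners, and let $(V_i)_{i\in I}$ be a locally finite cover of $M$ by relatively compact open sets. Here $C^\infty(M,F)$ is the space of smooth maps $\gamma\colon M\to F$: $\gamma$ is continuous and, for every chart $\varphi\colon U_\varphi\to V_\varphi$ of the maximal atlas (with $V_\varphi$ a subset with dense interior of the modelling space $E$), all iterated directional derivatives $d^{(k)}(\gamma\circ\varphi^{-1})(x,y_1,\dots,y_k)=D_{y_1}\cdots D_{y_k}(\gamma\circ\varphi^{-1})(x)$ exist on the interior of $V_\varphi$ and extend to continuous maps $V_\varphi\times E^k\to F$. It carries the compact-open $C^\infty$-topology, i.e. the initial topology with respect to the maps $\gamma\mapsto d^{(k)}(\gamma\circ\varphi^{-1})\in C(V_\varphi\times E^k,F)_{c.o.}$ for all $k\in\mathbb N_0$ and all charts $\varphi$. For $K\subseteq M$ compact, $C^\infty_K(M,F)\subseteq C^\infty(M,F)$ is the subspace of maps vanishing outside $K$, and $C^\infty_c(M,F)=\bigcup_K C^\infty_K(M,F)$ carries the locally convex direct limit topology, i.e. the finest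 locally convex vector topology making all inclusions $C^\infty_K(M,F)\to C^\infty_c(M,F)$ continuous. The direct sum $\bigoplus_{i\in I}C^\infty(V_i,F)$ carries the finest locally convex vector topology making the inclusions of all summands continuous. Then the restriction map \[ \Phi\colon C^\infty_c(M,F)\to\bigoplus_{i\in I}C^\infty(V_i,F),\qquad \gamma\mapsto(\gamma|_{V_i})_{i\in I} \] is well defined, and it is a linear topological embedding with closed image. Its image is the subspace \[ \mathfrak g_{\mathcal V}:=\Big\{(\eta_i)_{i\in I}\in\bigoplus_{i\in I}C^\infty(V_i,F) : \eta_i(x)=\eta_j(x)\text{ for all } i,j\in I \text{ and } x\in V_i\cap V_j\Big\}, \] and the gluing map $\mathrm{glue}\colon\mathfrak g_{\mathcal V}\to C^\infty_c(M,F)$, $\mathrm{glue}((\eta_i)_{i\in I})(x):=\eta_i(x)$ if $x\in V_i$, is well defined, linear, continuous (for the topology induced on $\mathfrak g_{\mathcal V}$ by the direct sum) and inverse to $\Phi\colon C^\infty_c(M,F)\to\mathfrak g_{\mathcal V}$. -/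

import Mathlib

open Set Filter Topology TopologicalSpace DirectSum
open scoped Manifold ContDiff

/-! ### Differential calculus with values in locally convex spaces -/

section Calculus

variable {E : Type*} [AddCommGroup E] [Module ℝ E]
variable {F : Type*} [AddCommGroup F] [Module ℝ F] [TopologicalSpace F]

/-- `l` is the directional derivative of `f` at `x` in the direction `v`: the limit of the
difference quotients `t⁻¹ • (f (x + t • v) - f x)` as `t → 0`, `t ≠ 0`. -/
def HasDirDeriv (f : E → F) (l : F) (x v : E) : Prop :=
  Tendsto (fun t : ℝ => t⁻¹ • (f (x + t • v) - f x)) (𝓝[≠] 0) (𝓝 l)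

/-- The directional derivative `D_v f (x)`, meaningful when `∃ l, HasDirDeriv f l x v`. -/
noncomputable def dirDeriv (f : E → F) (x v : E) : F :=
  limUnder (𝓝[≠] (0 : ℝ)) (fun t : ℝ => t⁻¹ • (f (x + t • v) - f x))

/-- The iterated directional derivative `d^(k) f (x, y₁, …, y_k) = D_{y₁} ⋯ D_{y_k} f (x)`. -/
noncomputable def iterDirDeriv (f : E → F) : (k : ℕ) → (Fin k → E) → E → F
  | 0, _, x => f x
  | k + 1, y, x => dirDeriv (iterDirDeriv f k (Fin.tail y)) x (y 0)

/-- `f` is `C^∞` on `V ⊆ E` (intended for locally convex sets `V` with dense interior): `f` is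
continuous on `V`, all iterated directional derivatives exist on the interior of `V`, and each
`d^(k) f`, defined on `interior V × E^k`, extends to a continuous map on `V × E^k`.
Only the values of `f` on `V` matter. -/
structure IsSmoothOn [TopologicalSpace E] (V : Set E) (f : E → F) : Prop where
  continuousOn : ContinuousOn f V
  exists_dirDeriv : ∀ (k : ℕ) (y : Fin k → E), ∀ x ∈ interior V, ∀ v : E,
    ∃ l : F, HasDirDeriv (iterDirDeriv f k y) l x v
  exists_extension : ∀ k : ℕ, ∃ G : E × (Fin k → E) → F,
    ContinuousOn G (V ×ˢ univ) ∧ ∀ x ∈ interior V, ∀ y, G (x, y) = iterDirDeriv f k y x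

/-- The continuous extension of `d^(k) f` from `interior V × E^k` to `V × E^k`. -/
noncomputable def extIterDirDeriv [TopologicalSpace E] (V : Set E) (f : E → F) (k : ℕ) :
    E × (Fin k → E) → F :=
  extendFrom (interior V ×ˢ univ) (fun p => iterDirDeriv f k p.2 p.1)

end Calculus

section CalculusFacts

variable {E : Type*} [NormedAddCommGroup E] [NormedSpace ℝ E]
variable {F : Type*} [AddCommGroup F] [Module ℝ F] [TopologicalSpace F] {V : Set E} {f g : E → F}

theorem HasDirDeriv.congr_of_eqOn {l : F} {x v : E} (h : HasDirDeriv f l x v)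
    (hx : x ∈ interior V) (hfg : ∀ z ∈ interior V, g z = f z) : HasDirDeriv g l x v := by
  have hc : Continuous fun t : ℝ => x + t • v := by fun_prop
  have h0 : ∀ᶠ t : ℝ in 𝓝[≠] 0, x + t • v ∈ interior V :=
    nhdsWithin_le_nhds (hc.continuousAt.eventually_mem (isOpen_interior.mem_nhds (by simpa using hx)))
  refine Tendsto.congr' ?_ h
  filter_upwards [h0] with t ht
  rw [hfg _ ht, hfg _ hx]

theorem IsSmoothOn.continuousOn_extIterDirDeriv [T2Space F] (h : IsSmoothOn V f)
    (hV : V ⊆ closure (interior V)) (k : ℕ) : ContinuousOn (extIterDirDeriv V f k) (V ×ˢ univ) := by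
  obtain ⟨G, hG, hGf⟩ := h.exists_extension k
  refine hG.congr fun p hp => ?_
  refine extendFrom_eq ?_ ?_
  · rw [closure_prod_eq, closure_univ]
    exact ⟨hV hp.1, mem_univ _⟩
  · refine ((hG p hp).mono (prod_mono_left interior_subset)).congr' ?_
    filter_upwards [self_mem_nhdsWithin] with q hq
    exact hGf q.1 hq.1 q.2

theorem HasDirDeriv.dirDeriv_eq [T2Space F] {l : F} {x v : E} (h : HasDirDeriv f l x v) :
    dirDeriv f x v = l :=
  Tendsto.limUnder_eq h

theorem HasDirDeriv.add [IsTopologicalAddGroup F] {l m : F} {x v : E} (hf : HasDirDeriv f l x v)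
    (hg : HasDirDeriv g m x v) : HasDirDeriv (fun z => f z + g z) (l + m) x v := by
  refine (Tendsto.add hf hg).congr fun t => ?_
  rw [← smul_add, add_sub_add_comm]

theorem HasDirDeriv.const_smul [ContinuousSMul ℝ F] {l : F} {x v : E} (c : ℝ) (hf : HasDirDeriv f l x v) :
    HasDirDeriv (fun z => c • f z) (c • l) x v := by
  refine (Tendsto.const_smul hf c).congr fun t => ?_
  rw [smul_comm, smul_sub]

variable [T2Space F]

theorem IsSmoothOn.iterDirDeriv_add [IsTopologicalAddGroup F] (hf : IsSmoothOn V f) (hg : IsSmoothOn V g) (k : ℕ)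
    (y : Fin k → E) : ∀ x ∈ interior V,
      iterDirDeriv (fun z => f z + g z) k y x = iterDirDeriv f k y x + iterDirDeriv g k y x := by
  induction k with
  | zero => intro x _; rfl
  | succ k ih =>
    intro x hx
    obtain ⟨l, hl⟩ := hf.exists_dirDeriv k (Fin.tail y) x hx (y 0)
    obtain ⟨m, hm⟩ := hg.exists_dirDeriv k (Fin.tail y) x hx (y 0)
    have := ((hl.add hm).congr_of_eqOn hx (ih (Fin.tail y))).dirDeriv_eq
    simp only [iterDirDeriv]
    rw [this, hl.dirDeriv_eq, hm.dirDeriv_eq]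

theorem IsSmoothOn.iterDirDeriv_const_smul [ContinuousSMul ℝ F] (c : ℝ) (hf : IsSmoothOn V f) (k : ℕ)
    (y : Fin k → E) : ∀ x ∈ interior V,
      iterDirDeriv (fun z => c • f z) k y x = c • iterDirDeriv f k y x := by
  induction k with
  | zero => intro x _; rfl
  | succ k ih =>
    intro x hx
    obtain ⟨l, hl⟩ := hf.exists_dirDeriv k (Fin.tail y) x hx (y 0)
    have := ((hl.const_smul c).congr_of_eqOn hx (ih (Fin.tail y))).dirDeriv_eq
    simp only [iterDirDeriv]
    rw [this, hl.dirDeriv_eq]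

theorem IsSmoothOn.add [IsTopologicalAddGroup F] (hf : IsSmoothOn V f) (hg : IsSmoothOn V g) :
    IsSmoothOn V (fun z => f z + g z) where
  continuousOn := hf.continuousOn.add hg.continuousOn
  exists_dirDeriv k y x hx v := by
    obtain ⟨l, hl⟩ := hf.exists_dirDeriv k y x hx v
    obtain ⟨m, hm⟩ := hg.exists_dirDeriv k y x hx v
    exact ⟨l + m, (hl.add hm).congr_of_eqOn hx (hf.iterDirDeriv_add hg k y)⟩
  exists_extension k := by
    obtain ⟨G, hG, hG'⟩ := hf.exists_extension k
    obtain ⟨G₂, hG₂, hG₂'⟩ := hg.exists_extension k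
    refine ⟨fun p => G p + G₂ p, hG.add hG₂, fun x hx y => ?_⟩
    simp only [hf.iterDirDeriv_add hg k y x hx, hG' x hx, hG₂' x hx]

theorem IsSmoothOn.const_smul [ContinuousSMul ℝ F] (c : ℝ) (hf : IsSmoothOn V f) :
    IsSmoothOn V (fun z => c • f z) where
  continuousOn := hf.continuousOn.const_smul c
  exists_dirDeriv k y x hx v := by
    obtain ⟨l, hl⟩ := hf.exists_dirDeriv k y x hx v
    exact ⟨c • l, (hl.const_smul c).congr_of_eqOn hx (hf.iterDirDeriv_const_smul c k y)⟩
  exists_extension k := by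
    obtain ⟨G, hG, hG'⟩ := hf.exists_extension k
    refine ⟨fun p => c • G p, hG.const_smul c, fun x hx y => ?_⟩
    simp only [hf.iterDirDeriv_const_smul c k y x hx, hG' x hx]

theorem isSmoothOn_zero : IsSmoothOn V (fun _ : E => (0 : F)) := by
  have h0 : ∀ x v : E, HasDirDeriv (fun _ : E => (0 : F)) 0 x v := fun x v => by
    simp [HasDirDeriv]
  have h1 : ∀ (k : ℕ) (y : Fin k → E), iterDirDeriv (fun _ : E => (0 : F)) k y = fun _ => 0 := by
    intro k
    induction k with
    | zero => intro y; rfl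
    | succ k ih =>
      intro y
      funext x
      simp only [iterDirDeriv, ih]
      exact (h0 x (y 0)).dirDeriv_eq
  refine ⟨continuousOn_const, fun k y x _ v => ⟨0, ?_⟩, fun k => ⟨fun _ => 0, continuousOn_const, ?_⟩⟩
  · rw [h1]; exact h0 x v
  · intro x _ y; rw [h1]

end CalculusFacts

/-! ### Locally convex inductive topologies and direct sums -/

/-- The finest locally convex vector space topology on `X` for which all maps `j k` are
continuous: the infimum (in the order where finer topologies are smaller) of all such topologies. -/
abbrev finestLocallyConvex {X : Type*} [AddCommGroup X] [Module ℝ X] {κ : Type*} {Y : κ → Type*}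
    [∀ k, TopologicalSpace (Y k)] (j : ∀ k, Y k → X) : TopologicalSpace X :=
  sInf {t | @IsTopologicalAddGroup X t _ ∧ @ContinuousSMul ℝ X _ _ t ∧
    @LocallyConvexSpace ℝ X _ _ _ _ t ∧ ∀ k, @Continuous (Y k) X _ t (j k)}

open Classical in
/-- The locally convex direct sum topology: the finest locally convex vector topology making all
the inclusions of the summands continuous. -/
noncomputable instance DirectSum.instLocallyConvexSumTopology {ι : Type*} (X : ι → Type*)
    [∀ i, AddCommGroup (X i)] [∀ i, Module ℝ (X i)] [∀ i, TopologicalSpace (X i)] :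
    TopologicalSpace (⨁ i, X i) :=
  finestLocallyConvex fun i => (DirectSum.lof ℝ ι X i : X i → ⨁ i, X i)

/-! ### Spaces of smooth maps on a manifold with corners -/

theorem extend_target_subset_closure_interior {E : Type*}
    [NormedAddCommGroup E] [NormedSpace ℝ E] {H : Type*} [TopologicalSpace H]
    {I : ModelWithCorners ℝ E H} {M : Type*} [TopologicalSpace M] (φ : OpenPartialHomeomorph M H) :
    (φ.extend I).target ⊆ closure (interior (φ.extend I).target) := by
  have ho : IsOpen (I.symm ⁻¹' φ.target) := φ.open_target.preimage I.continuous_symm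
  rw [φ.extend_target, interior_inter, ho.interior_eq]
  exact (inter_subset_inter_right _ I.range_subset_closure_interior).trans ho.inter_closure

section Spaces

variable {E : Type*} [NormedAddCommGroup E] [NormedSpace ℝ E]
  {H : Type*} [TopologicalSpace H] (I : ModelWithCorners ℝ E H)
  (M : Type*) [TopologicalSpace M] [ChartedSpace H M]
  (F : Type*) [AddCommGroup F] [Module ℝ F] [TopologicalSpace F]
  [IsTopologicalAddGroup F] [ContinuousSMul ℝ F] [T2Space F]

/-- The vector space of smooth maps `M → F`: continuous maps `f` such that `f ∘ φ⁻¹` is `C^∞` on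
the image of `φ` in `E`, for every chart `φ` of the maximal atlas. -/
def smoothMaps : Submodule ℝ (M → F) where
  carrier := {f | Continuous f ∧ ∀ φ ∈ IsManifold.maximalAtlas I ∞ M,
    IsSmoothOn (φ.extend I).target (f ∘ (φ.extend I).symm)}
  add_mem' hf hg := ⟨hf.1.add hg.1, fun φ hφ => (hf.2 φ hφ).add (hg.2 φ hφ)⟩
  zero_mem' := ⟨continuous_const, fun _ _ => isSmoothOn_zero⟩
  smul_mem' c _ hf := ⟨hf.1.const_smul c, fun φ hφ => (hf.2 φ hφ).const_smul c⟩

/-- The space `C^∞(M, F)`; it does not carry the topology of pointwise convergence, but the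
compact-open `C^∞`-topology defined below. -/
def SmoothMap : Type _ := smoothMaps I M F

noncomputable instance : AddCommGroup (SmoothMap I M F) :=
  inferInstanceAs (AddCommGroup (smoothMaps I M F))

noncomputable instance : Module ℝ (SmoothMap I M F) :=
  inferInstanceAs (Module ℝ (smoothMaps I M F))

instance : FunLike (SmoothMap I M F) M F where
  coe f := f.1
  coe_injective _ _ h := Subtype.ext h

variable {I M F} in
/-- For a chart `φ` with image `V_φ ⊆ E` and `γ ∈ C^∞(M, F)`, the continuous map
`d^(k) (γ ∘ φ⁻¹) : V_φ × E^k → F`. -/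
noncomputable def SmoothMap.chartDeriv (φ : IsManifold.maximalAtlas I ∞ M) (k : ℕ)
    (γ : SmoothMap I M F) :
    C(((φ.1.extend I).target ×ˢ univ : Set (E × (Fin k → E))), F) where
  toFun := ((φ.1.extend I).target ×ˢ univ).domRestrict
    (extIterDirDeriv (φ.1.extend I).target (γ ∘ (φ.1.extend I).symm) k)
  continuous_toFun := continuousOn_iff_continuous_domRestrict.1
    ((γ.2.2 φ.1 φ.2).continuousOn_extIterDirDeriv (extend_target_subset_closure_interior φ.1) k)

/-- The compact-open `C^∞`-topology on `C^∞(M, F)`: the initial topology with respect to all maps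
`γ ↦ d^(k) (γ ∘ φ⁻¹)` into `C(V_φ × E^k, F)` with the compact-open topology, for `k ∈ ℕ` and `φ`
in the maximal atlas. -/
noncomputable instance : TopologicalSpace (SmoothMap I M F) :=
  ⨅ (φ : IsManifold.maximalAtlas I ∞ M) (k : ℕ),
    TopologicalSpace.induced (SmoothMap.chartDeriv φ k) ContinuousMap.compactOpen

/-- The subspace `C^∞_K(M, F)` of smooth maps vanishing outside `K`, with the topology induced by
`C^∞(M, F)`. -/
def SmoothMap.supportedIn (K : Set M) : Submodule ℝ (SmoothMap I M F) where
  carrier := {γ | ∀ x ∉ K, γ x = 0}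
  add_mem' {f g} hf hg x hx := by
    change f x + g x = 0
    rw [hf x hx, hg x hx, add_zero]
  zero_mem' _ _ := rfl
  smul_mem' c f hf x hx := by
    change c • f x = 0
    rw [hf x hx, smul_zero]

/-- The vector space `⋃ C^∞_K(M, F)` over all compact `K ⊆ M`. -/
def compactlySupportedSmoothMaps : Submodule ℝ (SmoothMap I M F) where
  carrier := {γ | ∃ K : Set M, IsCompact K ∧ γ ∈ SmoothMap.supportedIn I M F K}
  add_mem' := by
    rintro f g ⟨K, hK, hf⟩ ⟨L, hL, hg⟩
    exact ⟨K ∪ L, hK.union hL, Submodule.add_mem _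
      (fun x hx => hf x fun h => hx (Or.inl h)) (fun x hx => hg x fun h => hx (Or.inr h))⟩
  zero_mem' := ⟨∅, isCompact_empty, Submodule.zero_mem _⟩
  smul_mem' := by
    rintro c f ⟨K, hK, hf⟩
    exact ⟨K, hK, Submodule.smul_mem _ c hf⟩

/-- The space `C^∞_c(M, F)`; it does not carry the topology induced by `C^∞(M, F)`, but the
locally convex direct limit topology defined below. -/
def SmoothMapC : Type _ := compactlySupportedSmoothMaps I M F

noncomputable instance : AddCommGroup (SmoothMapC I M F) :=
  inferInstanceAs (AddCommGroup (compactlySupportedSmoothMaps I M F))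

noncomputable instance : Module ℝ (SmoothMapC I M F) :=
  inferInstanceAs (Module ℝ (compactlySupportedSmoothMaps I M F))

instance : FunLike (SmoothMapC I M F) M F where
  coe f := (f.1 : M → F)
  coe_injective _ _ h := Subtype.ext (DFunLike.coe_injective h)

/-- The inclusion `C^∞_K(M, F) → C^∞_c(M, F)` for a compact set `K`. -/
def SmoothMapC.incl (K : Compacts M) (γ : SmoothMap.supportedIn I M F (K : Set M)) :
    SmoothMapC I M F :=
  ⟨γ.1, K, K.isCompact, γ.2⟩

/-- The topology of `C^∞_c(M, F)` as the locally convex direct limit of the spaces `C^∞_K(M, F)`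
over all compact `K ⊆ M`. -/
noncomputable instance : TopologicalSpace (SmoothMapC I M F) :=
  finestLocallyConvex (SmoothMapC.incl I M F)

variable {M} in
/-- The space of families `(η_i) ∈ ⨁ C^∞(V_i, F)` with `η_i = η_j` on `V_i ∩ V_j` for all `i, j`,
with the topology induced by the direct sum. -/
def gluedFamilies {ι : Type*} (V : ι → Opens M) : Submodule ℝ (⨁ i, SmoothMap I (V i) F) where
  carrier := {η | ∀ (i j : ι) (x : M) (hi : x ∈ V i) (hj : x ∈ V j), η i ⟨x, hi⟩ = η j ⟨x, hj⟩}
  add_mem' {f g} hf hg i j x hi hj := by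
    change f i ⟨x, hi⟩ + g i ⟨x, hi⟩ = f j ⟨x, hj⟩ + g j ⟨x, hj⟩
    rw [hf i j x hi hj, hg i j x hi hj]
  zero_mem' _ _ _ _ _ := rfl
  smul_mem' c f hf i j x hi hj := by
    change c • f i ⟨x, hi⟩ = c • f j ⟨x, hj⟩
    rw [hf i j x hi hj]

end Spaces

/-! ### Locality of the iterated directional derivatives -/

section Locality

theorem inter_subset_closure_interior_inter {X : Type*} [TopologicalSpace X] {V N : Set X}
    (hV : V ⊆ closure (interior V)) (hN : IsOpen N) :
    V ∩ N ⊆ closure (interior (V ∩ N)) := by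
  rw [interior_inter, hN.interior_eq]
  exact (inter_subset_inter_left _ hV).trans hN.closure_inter

variable {E : Type*} [NormedAddCommGroup E] [NormedSpace ℝ E]
variable {F : Type*} [AddCommGroup F] [Module ℝ F] [TopologicalSpace F] {V N : Set E} {f g : E → F}

theorem dirDeriv_congr_of_eqOn {x v : E} (hN : IsOpen N) (hx : x ∈ N) (hfg : EqOn f g N) :
    dirDeriv f x v = dirDeriv g x v := by
  have hc : Continuous fun t : ℝ => x + t • v := by fun_prop
  have h0 : ∀ᶠ t : ℝ in 𝓝[≠] 0, x + t • v ∈ N :=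
    nhdsWithin_le_nhds (hc.continuousAt.eventually_mem (hN.mem_nhds (by simpa using hx)))
  unfold dirDeriv limUnder
  congr 1
  refine Filter.map_congr ?_
  filter_upwards [h0] with t ht
  rw [hfg ht, hfg hx]

theorem iterDirDeriv_congr_of_eqOn (hN : IsOpen N) (hfg : EqOn f g N) (k : ℕ) (y : Fin k → E) :
    EqOn (iterDirDeriv f k y) (iterDirDeriv g k y) N := by
  induction k with
  | zero => exact hfg
  | succ k ih => exact fun x hx => dirDeriv_congr_of_eqOn hN hx (ih _)

theorem extIterDirDeriv_congr_of_eqOn (hfg : EqOn f g V) (k : ℕ) :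
    extIterDirDeriv V f k = extIterDirDeriv V g k := by
  funext p
  unfold extIterDirDeriv extendFrom limUnder
  congr 1
  refine Filter.map_congr ?_
  filter_upwards [self_mem_nhdsWithin] with q hq
  exact iterDirDeriv_congr_of_eqOn isOpen_interior (hfg.mono interior_subset) k q.2 hq.1

theorem extIterDirDeriv_inter_of_isOpen (hN : IsOpen N) (k : ℕ) {p : E × (Fin k → E)}
    (hp : p.1 ∈ N) : extIterDirDeriv (V ∩ N) f k p = extIterDirDeriv V f k p := by
  unfold extIterDirDeriv extendFrom
  congr 1
  rw [interior_inter, hN.interior_eq, ← inter_univ (univ : Set (Fin k → E)), ← prod_inter_prod,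
    inter_univ]
  exact nhdsWithin_inter_of_mem' (mem_nhdsWithin_of_mem_nhds
    ((hN.prod isOpen_univ).mem_nhds ⟨hp, mem_univ _⟩))

theorem IsSmoothOn.mono {V' : Set E} (h : IsSmoothOn V f) (hV : V' ⊆ V) : IsSmoothOn V' f where
  continuousOn := h.continuousOn.mono hV
  exists_dirDeriv k y x hx := h.exists_dirDeriv k y x (interior_mono hV hx)
  exists_extension k := by
    obtain ⟨G, hG, hGf⟩ := h.exists_extension k
    exact ⟨G, hG.mono (prod_mono_left hV), fun x hx => hGf x (interior_mono hV hx)⟩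

theorem IsSmoothOn.congr (h : IsSmoothOn V f) (hfg : EqOn g f V) : IsSmoothOn V g where
  continuousOn := h.continuousOn.congr hfg
  exists_dirDeriv k y x hx v := by
    obtain ⟨l, hl⟩ := h.exists_dirDeriv k y x hx v
    exact ⟨l, hl.congr_of_eqOn hx
      (iterDirDeriv_congr_of_eqOn isOpen_interior (hfg.mono interior_subset) k y)⟩
  exists_extension k := by
    obtain ⟨G, hG, hGf⟩ := h.exists_extension k
    refine ⟨G, hG, fun x hx y => ?_⟩
    rw [hGf x hx, iterDirDeriv_congr_of_eqOn isOpen_interior (hfg.mono interior_subset) k y hx]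

theorem IsSmoothOn.continuousOn_iterDirDeriv (h : IsSmoothOn V f) (k : ℕ) :
    ContinuousOn (fun p : E × (Fin k → E) => iterDirDeriv f k p.2 p.1) (interior V ×ˢ univ) := by
  obtain ⟨G, hG, hGf⟩ := h.exists_extension k
  exact (hG.mono (prod_mono_left interior_subset)).congr fun p hp => (hGf p.1 hp.1 p.2).symm

theorem HasDirDeriv.sum [IsTopologicalAddGroup F] {ι : Type*} {s : Finset ι} {f : ι → E → F}
    {l : ι → F} {x v : E}
    (hf : ∀ i ∈ s, HasDirDeriv (f i) (l i) x v) :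
    HasDirDeriv (fun z => ∑ i ∈ s, f i z) (∑ i ∈ s, l i) x v := by
  refine (tendsto_finsetSum s hf).congr fun t => ?_
  rw [← Finset.smul_sum, Finset.sum_sub_distrib]

variable [T2Space F]

theorem IsSmoothOn.hasDirDeriv_iterDirDeriv {f : E → F} (hf : IsSmoothOn V f) {k : ℕ}
    (y : Fin k → E) (v : E) {x : E} (hx : x ∈ interior V) :
    HasDirDeriv (iterDirDeriv f k y) (iterDirDeriv f (k + 1) (Fin.cons v y) x) x v := by
  obtain ⟨l, hl⟩ := hf.exists_dirDeriv k y x hx v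
  simp only [iterDirDeriv, Fin.cons_zero, Fin.tail_cons]
  rwa [hl.dirDeriv_eq]

theorem IsSmoothOn.extIterDirDeriv_eq_of_mem_interior (h : IsSmoothOn V f) (k : ℕ)
    {p : E × (Fin k → E)} (hp : p.1 ∈ interior V) :
    extIterDirDeriv V f k p = iterDirDeriv f k p.2 p.1 :=
  extendFrom_eq (subset_closure ⟨hp, mem_univ _⟩) (h.continuousOn_iterDirDeriv k p ⟨hp, mem_univ _⟩)

theorem IsSmoothOn.of_locally (hV : V ⊆ closure (interior V))
    (h : ∀ x ∈ V, ∃ N, IsOpen N ∧ x ∈ N ∧ IsSmoothOn (V ∩ N) f) : IsSmoothOn V f where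
  continuousOn x hx := by
    obtain ⟨N, hN, hxN, hf⟩ := h x hx
    exact (continuousWithinAt_inter (hN.mem_nhds hxN)).1 (hf.continuousOn x ⟨hx, hxN⟩)
  exists_dirDeriv k y x hx := by
    obtain ⟨N, hN, hxN, hf⟩ := h x (interior_subset hx)
    refine hf.exists_dirDeriv k y x ?_
    rw [interior_inter, hN.interior_eq]
    exact ⟨hx, hxN⟩
  exists_extension k := by
    refine ⟨extIterDirDeriv V f k, fun p hp => ?_, fun x hx y => ?_⟩
    · obtain ⟨N, hN, hxN, hf⟩ := h p.1 hp.1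
      have h1 := hf.continuousOn_extIterDirDeriv (inter_subset_closure_interior_inter hV hN) k
      have h2 : ContinuousOn (extIterDirDeriv V f k) ((V ∩ N) ×ˢ univ) :=
        h1.congr fun q hq => (extIterDirDeriv_inter_of_isOpen hN k hq.1.2).symm
      have h3 := h2 p ⟨⟨hp.1, hxN⟩, mem_univ _⟩
      rw [← inter_univ (univ : Set (Fin k → E)), ← prod_inter_prod] at h3
      exact (continuousWithinAt_inter ((hN.prod isOpen_univ).mem_nhds ⟨hxN, mem_univ _⟩)).1 h3
    · obtain ⟨N, hN, hxN, hf⟩ := h x (interior_subset hx)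
      rw [← extIterDirDeriv_inter_of_isOpen hN k hxN]
      refine hf.extIterDirDeriv_eq_of_mem_interior k ?_
      rw [interior_inter, hN.interior_eq]
      exact ⟨hx, hxN⟩

theorem extIterDirDeriv_zero {p : E × (Fin 0 → E)} (hf : ContinuousOn f V)
    (hV : V ⊆ closure (interior V)) (hp : p.1 ∈ V) : extIterDirDeriv V f 0 p = f p.1 := by
  refine extendFrom_eq ?_ ?_
  · rw [closure_prod_eq, closure_univ]
    exact ⟨hV hp, mem_univ _⟩
  · refine Tendsto.comp (hf p.1 hp) (tendsto_nhdsWithin_iff.2 ⟨?_, ?_⟩)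
    · exact continuous_fst.continuousAt.mono_left nhdsWithin_le_nhds
    · filter_upwards [self_mem_nhdsWithin] with q hq
      exact interior_subset hq.1

end Locality

/-! ### The Leibniz formula -/

section Leibniz

variable {E : Type*} [NormedAddCommGroup E] [NormedSpace ℝ E]
variable {F : Type*} [AddCommGroup F] [Module ℝ F] [TopologicalSpace F]
  [IsTopologicalAddGroup F] [ContinuousSMul ℝ F] {V : Set E}

theorem HasDirDeriv.smul {h : E → ℝ} {f : E → F} {l : ℝ} {m : F} {x v : E}
    (hh : HasDirDeriv h l x v) (hf : HasDirDeriv f m x v) :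
    HasDirDeriv (fun z => h z • f z) (l • f x + h x • m) x v := by
  have hc : Tendsto (fun t : ℝ => h (x + t • v)) (𝓝[≠] 0) (𝓝 (h x)) := by
    have h1 : Tendsto (fun t : ℝ => t * (t⁻¹ • (h (x + t • v) - h x)) + h x) (𝓝[≠] 0)
        (𝓝 (0 * l + h x)) :=
      ((tendsto_id.mono_left nhdsWithin_le_nhds).mul hh).add_const _
    rw [zero_mul, zero_add] at h1
    refine h1.congr' ?_
    filter_upwards [self_mem_nhdsWithin] with t (ht : t ≠ 0)
    rw [smul_eq_mul, mul_inv_cancel_left₀ ht, sub_add_cancel]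
  refine ((Tendsto.smul_const hh (f x)).add (hc.smul hf)).congr fun t => ?_
  simp only [smul_sub, sub_smul, smul_eq_mul, mul_smul, smul_comm _ (t⁻¹)]
  abel

variable (E F) in
/-- The iterated directional derivative of order `k` of a product is a universal finite sum of
products of iterated directional derivatives of the factors, in directions selected from
the given ones. -/
theorem exists_leibniz_formula [T2Space F] (k : ℕ) :
    ∃ (ι : Type) (_ : Fintype ι) (m n : ι → ℕ) (a : ∀ i, Fin (m i) → Fin k)
      (b : ∀ i, Fin (n i) → Fin k), ∀ (V : Set E) (h : E → ℝ) (f : E → F), IsSmoothOn V h →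
        IsSmoothOn V f → ∀ (y : Fin k → E), ∀ x ∈ interior V,
          iterDirDeriv (fun z => h z • f z) k y x =
            ∑ i, iterDirDeriv h (m i) (y ∘ a i) x • iterDirDeriv f (n i) (y ∘ b i) x := by
  induction k with
  | zero =>
    refine ⟨Unit, inferInstance, fun _ => 0, fun _ => 0, fun _ => id, fun _ => id, ?_⟩
    intro V h f _ _ y x _
    simp [iterDirDeriv]
  | succ k ih =>
    obtain ⟨ι, hι, m, n, a, b, H⟩ := ih
    refine ⟨ι ⊕ ι, inferInstance, Sum.elim (fun i => m i + 1) m, Sum.elim n (fun i => n i + 1),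
      fun s => match s with
        | .inl i => Fin.cons 0 (Fin.succ ∘ a i)
        | .inr i => Fin.succ ∘ a i,
      fun s => match s with
        | .inl i => Fin.succ ∘ b i
        | .inr i => Fin.cons 0 (Fin.succ ∘ b i), ?_⟩
    intro V h f hh hf y x hx
    have h1 := (HasDirDeriv.sum (s := Finset.univ) fun i _ =>
      (hh.hasDirDeriv_iterDirDeriv (Fin.tail y ∘ a i) (y 0) hx).smul
        (hf.hasDirDeriv_iterDirDeriv (Fin.tail y ∘ b i) (y 0) hx)).congr_of_eqOn hx
      (H V h f hh hf (Fin.tail y))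
    rw [Fintype.sum_sum_type]
    refine h1.dirDeriv_eq.trans ?_
    rw [Finset.sum_add_distrib]
    rfl

theorem IsSmoothOn.continuousOn_sum_smul [T2Space F] {ι : Type*} [Fintype ι] {k : ℕ} {h : E → ℝ}
    {f : E → F} (hV : V ⊆ closure (interior V)) (hh : IsSmoothOn V h) (hf : IsSmoothOn V f)
    {m n : ι → ℕ} (a : ∀ i, Fin (m i) → Fin k) (b : ∀ i, Fin (n i) → Fin k) :
    ContinuousOn (fun p : E × (Fin k → E) => ∑ i, extIterDirDeriv V h (m i) (p.1, p.2 ∘ a i) •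
      extIterDirDeriv V f (n i) (p.1, p.2 ∘ b i)) (V ×ˢ univ) := by
  refine continuousOn_finsetSum _ fun i _ => ?_
  exact ((hh.continuousOn_extIterDirDeriv hV (m i)).comp (by fun_prop)
    fun p hp => ⟨hp.1, mem_univ _⟩).smul ((hf.continuousOn_extIterDirDeriv hV (n i)).comp
      (by fun_prop) fun p hp => ⟨hp.1, mem_univ _⟩)

theorem IsSmoothOn.smul [T2Space F] {h : E → ℝ} {f : E → F} (hV : V ⊆ closure (interior V))
    (hh : IsSmoothOn V h) (hf : IsSmoothOn V f) : IsSmoothOn V (fun z => h z • f z) where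
  continuousOn := hh.continuousOn.smul hf.continuousOn
  exists_dirDeriv k y x hx v := by
    obtain ⟨ι, _, m, n, a, b, H⟩ := exists_leibniz_formula E F k
    exact ⟨_, (HasDirDeriv.sum (s := Finset.univ) fun i _ =>
      (hh.hasDirDeriv_iterDirDeriv (y ∘ a i) v hx).smul
        (hf.hasDirDeriv_iterDirDeriv (y ∘ b i) v hx)).congr_of_eqOn hx (H V h f hh hf y)⟩
  exists_extension k := by
    obtain ⟨ι, _, m, n, a, b, H⟩ := exists_leibniz_formula E F k
    refine ⟨fun p => ∑ i, extIterDirDeriv V h (m i) (p.1, p.2 ∘ a i) •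
      extIterDirDeriv V f (n i) (p.1, p.2 ∘ b i),
      hh.continuousOn_sum_smul hV hf a b, fun x hx y => ?_⟩
    rw [H V h f hh hf y x hx]
    refine Finset.sum_congr rfl fun i _ => ?_
    rw [hh.extIterDirDeriv_eq_of_mem_interior _ hx, hf.extIterDirDeriv_eq_of_mem_interior _ hx]

variable (E F) in
theorem exists_leibniz_formula_ext [T2Space F] (k : ℕ) :
    ∃ (ι : Type) (_ : Fintype ι) (m n : ι → ℕ) (a : ∀ i, Fin (m i) → Fin k)
      (b : ∀ i, Fin (n i) → Fin k), ∀ (V : Set E) (h : E → ℝ) (f : E → F),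
        V ⊆ closure (interior V) → IsSmoothOn V h → IsSmoothOn V f → ∀ p : E × (Fin k → E),
          p.1 ∈ V → extIterDirDeriv V (fun z => h z • f z) k p =
            ∑ i, extIterDirDeriv V h (m i) (p.1, p.2 ∘ a i) •
              extIterDirDeriv V f (n i) (p.1, p.2 ∘ b i) := by
  obtain ⟨ι, hι, m, n, a, b, H⟩ := exists_leibniz_formula E F k
  refine ⟨ι, hι, m, n, a, b, fun V h f hV hh hf p hp => extendFrom_eq ?_ ?_⟩
  · rw [closure_prod_eq, closure_univ]
    exact ⟨hV hp, mem_univ _⟩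
  · refine ((hh.continuousOn_sum_smul hV hf a b p ⟨hp, mem_univ _⟩).mono
      (prod_mono_left interior_subset)).congr' ?_
    filter_upwards [self_mem_nhdsWithin] with q hq
    rw [H V h f hh hf q.2 q.1 hq.1]
    refine Finset.sum_congr rfl fun i _ => ?_
    rw [hh.extIterDirDeriv_eq_of_mem_interior (p := (q.1, q.2 ∘ a i)) _ hq.1,
      hf.extIterDirDeriv_eq_of_mem_interior (p := (q.1, q.2 ∘ b i)) _ hq.1]

theorem ContDiffOn.iterDirDeriv_eq {h : E → ℝ} (hh : ContDiffOn ℝ ∞ h V) (k : ℕ) (y : Fin k → E) :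
    ∀ x ∈ interior V, iterDirDeriv h k y x = iteratedFDeriv ℝ k h x y ∧
      ∀ v, HasDirDeriv (iterDirDeriv h k y)
        (fderiv ℝ (iteratedFDeriv ℝ k h) x v y) x v := by
  have key : ∀ (k : ℕ) (y : Fin k → E), ∀ x ∈ interior V, ∀ v,
      HasDirDeriv (fun z => iteratedFDeriv ℝ k h z y)
        (fderiv ℝ (iteratedFDeriv ℝ k h) x v y) x v := by
    intro k y x hx v
    have hd : ContDiffAt ℝ ∞ h x := hh.contDiffAt (mem_interior_iff_mem_nhds.1 hx)
    have h1 : DifferentiableAt ℝ (iteratedFDeriv ℝ k h) x :=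
      hd.differentiableAt_iteratedFDeriv (by exact_mod_cast WithTop.coe_lt_top _)
    have h2 := hasLineDerivAt_iff_tendsto_slope_zero.1 (h1.hasFDerivAt.hasLineDerivAt v)
    exact (((ContinuousMultilinearMap.apply ℝ (fun _ : Fin k => E) ℝ y).continuous.tendsto _).comp
      h2).congr fun t => by simp
  induction k with
  | zero =>
    intro x hx
    refine ⟨by simp [iterDirDeriv], fun v => ?_⟩
    refine (key 0 y x hx v).congr_of_eqOn hx fun z _ => ?_
    simp [iterDirDeriv]
  | succ k ih =>
    have h1 : ∀ x ∈ interior V, iterDirDeriv h (k + 1) y x = iteratedFDeriv ℝ (k + 1) h x y := by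
      intro x hx
      rw [iteratedFDeriv_succ_apply_left]
      exact ((ih (Fin.tail y) x hx).2 (y 0)).dirDeriv_eq
    exact fun x hx => ⟨h1 x hx, fun v => (key (k + 1) y x hx v).congr_of_eqOn hx h1⟩

theorem ContDiffOn.isSmoothOn {h : E → ℝ} (hh : ContDiffOn ℝ ∞ h V) (hV : UniqueDiffOn ℝ V) :
    IsSmoothOn V h where
  continuousOn := hh.continuousOn
  exists_dirDeriv k y x hx v := ⟨_, (hh.iterDirDeriv_eq k y x hx).2 v⟩
  exists_extension k := by
    refine ⟨fun p => iteratedFDerivWithin ℝ k h V p.1 p.2, ?_, fun x hx y => ?_⟩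
    · have h1 : ContinuousOn (iteratedFDerivWithin ℝ k h V) V :=
        hh.continuousOn_iteratedFDerivWithin (by exact_mod_cast le_top) hV
      exact (h1.comp continuousOn_fst fun p hp => hp.1).eval continuousOn_snd
    · rw [(hh.iterDirDeriv_eq k y x hx).1]
      have h2 : V =ᶠ[𝓝 x] univ := eventuallyEq_univ.2 (mem_interior_iff_mem_nhds.1 hx)
      simp only [iteratedFDerivWithin_congr_set h2, iteratedFDerivWithin_univ]

end Leibniz

/-! ### Charts of open submanifolds -/

section Charts

variable {E : Type*} [NormedAddCommGroup E] [NormedSpace ℝ E]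
  {H : Type*} [TopologicalSpace H] {I : ModelWithCorners ℝ E H}
  {M : Type*} [TopologicalSpace M] [ChartedSpace H M]

theorem StructureGroupoid.subtypeRestr_mem_maximalAtlas_of_mem_maximalAtlas
    {G : StructureGroupoid H} [ClosedUnderRestriction G] {e : OpenPartialHomeomorph M H}
    (he : e ∈ G.maximalAtlas M) {U : Opens M} (hU : Nonempty U) :
    e.subtypeRestr hU ∈ G.maximalAtlas U := by
  intro e' he'
  obtain ⟨x, rfl⟩ := Opens.chart_eq hU he'
  have h1 := he _ (chart_mem_atlas H (x : M))
  exact ⟨G.mem_of_eqOnSource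
      (closedUnderRestriction' h1.1 (e.isOpen_inter_preimage_symm U.2))
      (e.subtypeRestr_symm_trans_subtypeRestr hU _),
    G.mem_of_eqOnSource
      (closedUnderRestriction' h1.2 ((chartAt H (x : M)).isOpen_inter_preimage_symm U.2))
      ((chartAt H (x : M)).subtypeRestr_symm_trans_subtypeRestr hU _)⟩

theorem OpenPartialHomeomorph.lift_openEmbedding_mem_maximalAtlas [Nonempty H] [IsManifold I ∞ M]
    {U : Opens M} {ψ : OpenPartialHomeomorph U H} (hψ : ψ ∈ IsManifold.maximalAtlas I ∞ U) :
    ψ.lift_openEmbedding U.isOpenEmbedding' ∈ IsManifold.maximalAtlas I ∞ M := by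
  refine OpenPartialHomeomorph.mem_maximalAtlas_of_contMDiffOn _ ?_ ?_
  · rintro _ ⟨x, hx, rfl⟩
    refine (contMDiffAt_subtype_iff.1 ?_).contMDiffWithinAt
    refine (contMDiffAt_of_mem_maximalAtlas hψ hx).congr_of_eventuallyEq (.of_forall fun z => ?_)
    exact ψ.lift_openEmbedding_apply U.isOpenEmbedding'
  · exact contMDiff_subtype_val.comp_contMDiffOn (contMDiffOn_symm_of_mem_maximalAtlas hψ)

omit [ChartedSpace H M] in
theorem OpenPartialHomeomorph.extend_target_subtypeRestr (φ : OpenPartialHomeomorph M H)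
    {U : Opens M} (hU : Nonempty U) :
    ((φ.subtypeRestr hU).extend I).target =
      (φ.extend I).target ∩ (φ.extend I).symm ⁻¹' U := by
  have h : (φ.subtypeRestr hU).target = φ.target ∩ φ.symm ⁻¹' U := by
    simp [OpenPartialHomeomorph.subtypeRestr_def]
  rw [OpenPartialHomeomorph.extend_target, OpenPartialHomeomorph.extend_target, h]
  ext z
  simp only [mem_inter_iff, mem_preimage, OpenPartialHomeomorph.extend_coe_symm,
    Function.comp_apply]
  tauto

omit [ChartedSpace H M] in
theorem OpenPartialHomeomorph.coe_extend_symm_subtypeRestr (φ : OpenPartialHomeomorph M H)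
    {U : Opens M} (hU : Nonempty U) {z : E} (hz : z ∈ ((φ.subtypeRestr hU).extend I).target) :
    (((φ.subtypeRestr hU).extend I).symm z : M) = (φ.extend I).symm z := by
  rw [OpenPartialHomeomorph.extend_target] at hz
  exact φ.subtypeRestr_symm_apply hU hz.1

omit [ChartedSpace H M] in
theorem OpenPartialHomeomorph.exists_isOpen_preimage_extend_symm_inter_target
    (φ : OpenPartialHomeomorph M H) {U : Set M} (hU : IsOpen U) :
    ∃ N : Set E, IsOpen N ∧ (φ.extend I).target ∩ (φ.extend I).symm ⁻¹' U =
      (φ.extend I).target ∩ N := by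
  obtain ⟨N, hN, h⟩ := continuousOn_iff'.1 (φ.continuousOn_extend_symm (I := I)) U hU
  exact ⟨N, hN, by rw [inter_comm, h, inter_comm]⟩

theorem ContMDiff.isSmoothOn_comp_extend_symm {h : M → ℝ} (hh : ContMDiff I 𝓘(ℝ, ℝ) ∞ h)
    {φ : OpenPartialHomeomorph M H} (hφ : φ ∈ IsManifold.maximalAtlas I ∞ M) :
    IsSmoothOn (φ.extend I).target (h ∘ (φ.extend I).symm) := by
  refine ContDiffOn.isSmoothOn ?_ ?_
  · rw [φ.extend_target']
    exact (hh.comp_contMDiffOn (contMDiffOn_extend_symm hφ)).contDiffOn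
  · rw [φ.extend_target, inter_comm]
    exact I.uniqueDiffOn.inter (φ.open_target.preimage I.continuous_symm)

omit [ChartedSpace H M] in
theorem OpenPartialHomeomorph.isLocallyClosed_extend_target (φ : OpenPartialHomeomorph M H) :
    IsLocallyClosed (φ.extend I).target := by
  rw [φ.extend_target]
  exact (φ.open_target.preimage I.continuous_symm).isLocallyClosed.inter
    I.isClosed_range.isLocallyClosed

end Charts

/-! ### The compact-open topology on spaces of smooth maps -/

namespace SmoothMap

variable {E : Type*} [NormedAddCommGroup E] [NormedSpace ℝ E]
  {H : Type*} [TopologicalSpace H] {I : ModelWithCorners ℝ E H}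
  {M : Type*} [TopologicalSpace M] [ChartedSpace H M]
  {F : Type*} [AddCommGroup F] [Module ℝ F] [TopologicalSpace F]
  [IsTopologicalAddGroup F] [ContinuousSMul ℝ F] [T2Space F]

theorem isSmoothOn (γ : SmoothMap I M F) {φ : OpenPartialHomeomorph M H}
    (hφ : φ ∈ IsManifold.maximalAtlas I ∞ M) :
    IsSmoothOn (φ.extend I).target (γ ∘ (φ.extend I).symm) :=
  γ.2.2 φ hφ

theorem continuous_chartDeriv (φ : IsManifold.maximalAtlas I ∞ M) (k : ℕ) :
    Continuous (chartDeriv φ k : SmoothMap I M F → _) :=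
  continuous_iff_le_induced.2 ((iInf_le _ φ).trans (iInf_le _ k))

theorem continuous_iff_chartDeriv {X : Type*} [TopologicalSpace X] {T : X → SmoothMap I M F} :
    Continuous T ↔ ∀ (φ : IsManifold.maximalAtlas I ∞ M) (k : ℕ),
      Continuous fun x => chartDeriv φ k (T x) :=
  continuous_iInf_rng.trans (forall_congr' fun _ => continuous_iInf_rng.trans
    (forall_congr' fun _ => continuous_induced_rng))

theorem continuous_of_continuousOn_extIterDirDeriv {X : Type*} [TopologicalSpace X]
    {T : X → SmoothMap I M F}
    (hT : ∀ φ ∈ IsManifold.maximalAtlas I ∞ M, ∀ k : ℕ,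
      ContinuousOn (fun q : X × (E × (Fin k → E)) =>
        extIterDirDeriv (φ.extend I).target (T q.1 ∘ (φ.extend I).symm) k q.2)
        (univ ×ˢ ((φ.extend I).target ×ˢ univ))) : Continuous T := by
  refine continuous_iff_chartDeriv.2 fun φ k => ?_
  refine ContinuousMap.continuous_of_continuous_uncurry _ ?_
  exact (hT φ.1 φ.2 k).comp_continuous (continuous_id.prodMap continuous_subtype_val)
    fun q => ⟨mem_univ _, q.2.2⟩

theorem continuousOn_extIterDirDeriv [FiniteDimensional ℝ E] {φ : OpenPartialHomeomorph M H}
    (hφ : φ ∈ IsManifold.maximalAtlas I ∞ M) (k : ℕ) :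
    ContinuousOn (fun q : SmoothMap I M F × (E × (Fin k → E)) =>
      extIterDirDeriv (φ.extend I).target (q.1 ∘ (φ.extend I).symm) k q.2)
      (univ ×ˢ ((φ.extend I).target ×ˢ univ)) := by
  have : LocallyCompactSpace ((φ.extend I).target ×ˢ univ : Set (E × (Fin k → E))) :=
    (prod_univ (s := (φ.extend I).target) ▸
      φ.isLocallyClosed_extend_target.preimage continuous_fst).locallyCompactSpace
  have h1 : Continuous fun q : SmoothMap I M F ×
      ((φ.extend I).target ×ˢ univ : Set (E × (Fin k → E))) => chartDeriv ⟨φ, hφ⟩ k q.1 q.2 :=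
    ((continuous_chartDeriv ⟨φ, hφ⟩ k).comp continuous_fst).eval continuous_snd
  rw [continuousOn_iff_continuous_domRestrict]
  exact h1.comp (f := fun q : (univ ×ˢ ((φ.extend I).target ×ˢ univ) :
    Set (SmoothMap I M F × (E × (Fin k → E)))) => (q.1.1, ⟨q.1.2, q.2.2⟩)) (by fun_prop)

theorem continuous_eval_const [IsManifold I ∞ M] (x : M) :
    Continuous fun γ : SmoothMap I M F => γ x := by
  let φ : IsManifold.maximalAtlas I ∞ M := ⟨chartAt H x, IsManifold.chart_mem_maximalAtlas x⟩
  have hx : x ∈ (φ.1.extend I).source := by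
    rw [OpenPartialHomeomorph.extend_source]
    exact mem_chart_source H x
  have hz := (φ.1.extend I).map_source hx
  have h1 : Continuous fun γ : SmoothMap I M F =>
      chartDeriv φ 0 γ ⟨(φ.1.extend I x, 0), hz, mem_univ _⟩ :=
    (continuous_chartDeriv φ 0).eval_const _
  refine h1.congr fun γ => ?_
  refine (extIterDirDeriv_zero (γ.isSmoothOn φ.2).continuousOn
    (extend_target_subset_closure_interior φ.1) hz).trans ?_
  exact congrArg γ ((φ.1.extend I).left_inv hx)

/-! ### Restriction to an open subset -/

/-- The restriction of smooth maps to an open subset, as a linear map. -/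
def restrict [IsManifold I ∞ M] (U : Opens M) : SmoothMap I M F →ₗ[ℝ] SmoothMap I U F where
  toFun γ := (⟨fun x => γ x, γ.2.1.comp continuous_subtype_val, fun ψ hψ => by
    have : Nonempty H := ⟨I.symm 0⟩
    exact γ.isSmoothOn (OpenPartialHomeomorph.lift_openEmbedding_mem_maximalAtlas hψ)⟩ :
      smoothMaps I U F)
  map_add' _ _ := rfl
  map_smul' _ _ := rfl

theorem continuous_restrict [IsManifold I ∞ M] (U : Opens M) :
    Continuous (restrict U : SmoothMap I M F →ₗ[ℝ] SmoothMap I U F) := by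
  have : Nonempty H := ⟨I.symm 0⟩
  refine continuous_iff_chartDeriv.2 fun ψ k => ?_
  exact continuous_chartDeriv
    ⟨_, OpenPartialHomeomorph.lift_openEmbedding_mem_maximalAtlas ψ.2⟩ k

/-! ### Multiplication by a cut-off function and extension by zero -/

section MulExtend

variable {U : Opens M} {h : M → ℝ}

open Classical in
/-- The function on `M` which is `h • η` on `U`, and `0` outside `U`. -/
noncomputable def mulExtendFun (U : Opens M) (h : M → ℝ) (η : U → F) (x : M) : F :=
  if hx : x ∈ U then h x • η ⟨x, hx⟩ else 0

omit [TopologicalSpace F] [IsTopologicalAddGroup F] [ContinuousSMul ℝ F] [T2Space F]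
  [ChartedSpace H M] in
theorem mulExtendFun_of_mem (η : U → F) {x : M} (hx : x ∈ U) :
    mulExtendFun U h η x = h x • η ⟨x, hx⟩ :=
  dif_pos hx

omit [TopologicalSpace F] [IsTopologicalAddGroup F] [ContinuousSMul ℝ F] [T2Space F]
  [ChartedSpace H M] in
theorem mulExtendFun_of_notMem_tsupport (η : U → F) {x : M} (hx : x ∉ tsupport h) :
    mulExtendFun U h η x = 0 := by
  unfold mulExtendFun
  split_ifs
  · rw [image_eq_zero_of_notMem_tsupport hx, zero_smul]
  · rfl

theorem eqOn_mulExtendFun (η : SmoothMap I U F) (hU : Nonempty U) (φ : OpenPartialHomeomorph M H) :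
    EqOn (mulExtendFun U h η ∘ (φ.extend I).symm)
      (fun z => (h ∘ (φ.extend I).symm) z • (η ∘ ((φ.subtypeRestr hU).extend I).symm) z)
      ((φ.subtypeRestr hU).extend I).target := by
  intro z hz
  have h1 := φ.coe_extend_symm_subtypeRestr hU hz
  have h2 : (φ.extend I).symm z ∈ U := h1 ▸ (((φ.subtypeRestr hU).extend I).symm z).2
  simp only [Function.comp_apply]
  rw [mulExtendFun_of_mem _ h2]
  congr 2
  exact Subtype.ext h1.symm

omit [IsTopologicalAddGroup F] [T2Space F] in
theorem continuous_mulExtendFun (hh : Continuous h) (hhU : tsupport h ⊆ U) {η : U → F}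
    (hη : Continuous η) : Continuous (mulExtendFun U h η) := by
  refine continuous_iff_continuousAt.2 fun x => ?_
  by_cases hx : x ∈ U
  · have h1 : ContinuousOn (mulExtendFun U h η) U := by
      rw [continuousOn_iff_continuous_domRestrict]
      exact ((hh.comp continuous_subtype_val).smul hη).congr fun z =>
        (mulExtendFun_of_mem η z.2).symm
    exact h1.continuousAt (U.2.mem_nhds hx)
  · refine continuousAt_const.congr (f := fun _ => 0) ?_
    filter_upwards [(isClosed_tsupport h).isOpen_compl.mem_nhds fun hx' => hx (hhU hx')] with z hz
    exact (mulExtendFun_of_notMem_tsupport η hz).symm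

theorem isSmoothOn_mulExtendFun (hU : Nonempty U) (hh : ContMDiff I 𝓘(ℝ, ℝ) ∞ h)
    (hhU : tsupport h ⊆ U) (η : SmoothMap I U F) {φ : OpenPartialHomeomorph M H}
    (hφ : φ ∈ IsManifold.maximalAtlas I ∞ M) :
    IsSmoothOn (φ.extend I).target (mulExtendFun U h η ∘ (φ.extend I).symm) := by
  refine IsSmoothOn.of_locally (extend_target_subset_closure_interior φ) fun z hz => ?_
  by_cases hx : (φ.extend I).symm z ∈ U
  · obtain ⟨N, hN, hNU⟩ := φ.exists_isOpen_preimage_extend_symm_inter_target (I := I) U.2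
    refine ⟨N, hN, (hNU.subset ⟨hz, hx⟩).2, ?_⟩
    have hT : (φ.extend I).target ∩ N = ((φ.subtypeRestr hU).extend I).target :=
      hNU.symm.trans (φ.extend_target_subtypeRestr hU).symm
    rw [hT]
    refine IsSmoothOn.congr ?_ (eqOn_mulExtendFun η hU φ)
    refine IsSmoothOn.smul (extend_target_subset_closure_interior _) ?_ ?_
    · exact (hh.isSmoothOn_comp_extend_symm hφ).mono (hT ▸ inter_subset_left)
    · exact η.isSmoothOn
        (StructureGroupoid.subtypeRestr_mem_maximalAtlas_of_mem_maximalAtlas hφ hU)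
  · obtain ⟨N, hN, hNU⟩ := φ.exists_isOpen_preimage_extend_symm_inter_target (I := I)
      (isClosed_tsupport h).isOpen_compl
    refine ⟨N, hN, (hNU.subset ⟨hz, fun hx' => hx (hhU hx')⟩).2, isSmoothOn_zero.congr ?_⟩
    rw [← hNU]
    exact fun w hw => mulExtendFun_of_notMem_tsupport _ hw.2

theorem continuousOn_extIterDirDeriv_mulExtendFun [FiniteDimensional ℝ E] (hU : Nonempty U)
    (hh : ContMDiff I 𝓘(ℝ, ℝ) ∞ h) (hhU : tsupport h ⊆ U) {φ : OpenPartialHomeomorph M H}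
    (hφ : φ ∈ IsManifold.maximalAtlas I ∞ M) (k : ℕ) :
    ContinuousOn (fun q : SmoothMap I U F × (E × (Fin k → E)) =>
      extIterDirDeriv (φ.extend I).target (mulExtendFun U h q.1 ∘ (φ.extend I).symm) k q.2)
      (univ ×ˢ ((φ.extend I).target ×ˢ univ)) := by
  have key : ∀ N : Set E, IsOpen N →
      ContinuousOn (fun q : SmoothMap I U F × (E × (Fin k → E)) =>
        extIterDirDeriv ((φ.extend I).target ∩ N) (mulExtendFun U h q.1 ∘ (φ.extend I).symm) k q.2)
        (univ ×ˢ (((φ.extend I).target ∩ N) ×ˢ univ)) →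
      ∀ q ∈ (univ ×ˢ (((φ.extend I).target ∩ N) ×ˢ univ) :
        Set (SmoothMap I U F × (E × (Fin k → E)))),
      ContinuousWithinAt (fun q : SmoothMap I U F × (E × (Fin k → E)) =>
        extIterDirDeriv (φ.extend I).target (mulExtendFun U h q.1 ∘ (φ.extend I).symm) k q.2)
        (univ ×ˢ ((φ.extend I).target ×ˢ univ)) q := by
    intro N hN hc q hq
    have h1 := (hc.congr fun q hq => (extIterDirDeriv_inter_of_isOpen hN k hq.2.1.2).symm) q hq
    have h2 : (univ ×ˢ (((φ.extend I).target ∩ N) ×ˢ univ) :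
        Set (SmoothMap I U F × (E × (Fin k → E)))) =
        univ ×ˢ ((φ.extend I).target ×ˢ univ) ∩ univ ×ˢ (N ×ˢ univ) := by
      simp only [prod_inter_prod, inter_univ]
    rw [h2] at h1
    exact (continuousWithinAt_inter ((isOpen_univ.prod (hN.prod isOpen_univ)).mem_nhds
      ⟨mem_univ _, hq.2.1.2, mem_univ _⟩)).1 h1
  intro q hq
  by_cases hx : (φ.extend I).symm q.2.1 ∈ U
  · obtain ⟨N, hN, hNU⟩ := φ.exists_isOpen_preimage_extend_symm_inter_target (I := I) U.2
    refine key N hN ?_ q ⟨mem_univ _, hNU.subset ⟨hq.2.1, hx⟩, mem_univ _⟩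
    have hT : (φ.extend I).target ∩ N = ((φ.subtypeRestr hU).extend I).target :=
      hNU.symm.trans (φ.extend_target_subtypeRestr hU).symm
    have hφU : φ.subtypeRestr hU ∈ IsManifold.maximalAtlas I ∞ U :=
      StructureGroupoid.subtypeRestr_mem_maximalAtlas_of_mem_maximalAtlas hφ hU
    have hV := extend_target_subset_closure_interior (I := I) (φ.subtypeRestr hU)
    have hhT : IsSmoothOn ((φ.subtypeRestr hU).extend I).target (h ∘ (φ.extend I).symm) :=
      (hh.isSmoothOn_comp_extend_symm hφ).mono (hT ▸ inter_subset_left)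
    rw [hT]
    obtain ⟨κ, _, m, n, a, b, hL⟩ := exists_leibniz_formula_ext E F k
    have h1 : ContinuousOn (fun q : SmoothMap I U F × (E × (Fin k → E)) =>
        ∑ i, extIterDirDeriv ((φ.subtypeRestr hU).extend I).target (h ∘ (φ.extend I).symm) (m i)
            (q.2.1, q.2.2 ∘ a i) •
          extIterDirDeriv ((φ.subtypeRestr hU).extend I).target
            (q.1 ∘ ((φ.subtypeRestr hU).extend I).symm) (n i) (q.2.1, q.2.2 ∘ b i))
        (univ ×ˢ (((φ.subtypeRestr hU).extend I).target ×ˢ univ)) := by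
      refine continuousOn_finsetSum _ fun i _ => ContinuousOn.smul ?_ ?_
      · exact (hhT.continuousOn_extIterDirDeriv hV (m i)).comp
          (f := fun q : SmoothMap I U F × (E × (Fin k → E)) => (q.2.1, q.2.2 ∘ a i))
          (by fun_prop) fun q hq => ⟨hq.2.1, mem_univ _⟩
      · exact (continuousOn_extIterDirDeriv hφU (n i)).comp
          (f := fun q : SmoothMap I U F × (E × (Fin k → E)) => (q.1, q.2.1, q.2.2 ∘ b i))
          (by fun_prop) fun q hq => ⟨mem_univ _, hq.2.1, mem_univ _⟩
    refine h1.congr fun q hq => ?_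
    rw [extIterDirDeriv_congr_of_eqOn (eqOn_mulExtendFun q.1 hU φ) k]
    exact hL _ _ _ hV hhT (q.1.isSmoothOn hφU) q.2 hq.2.1
  · obtain ⟨N, hN, hNU⟩ := φ.exists_isOpen_preimage_extend_symm_inter_target (I := I)
      (isClosed_tsupport h).isOpen_compl
    refine key N hN ?_ q ⟨mem_univ _, hNU.subset ⟨hq.2.1, fun hx' => hx (hhU hx')⟩, mem_univ _⟩
    have h1 : ContinuousOn (fun q : SmoothMap I U F × (E × (Fin k → E)) =>
        extIterDirDeriv ((φ.extend I).target ∩ N) (fun _ => (0 : F)) k q.2)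
        (univ ×ˢ (((φ.extend I).target ∩ N) ×ˢ univ)) :=
      (isSmoothOn_zero.continuousOn_extIterDirDeriv (inter_subset_closure_interior_inter
        (extend_target_subset_closure_interior φ) hN) k).comp continuousOn_snd fun q hq => hq.2
    refine h1.congr fun q _ => ?_
    refine congrFun (extIterDirDeriv_congr_of_eqOn ?_ k) _
    rw [← hNU]
    exact fun w hw => mulExtendFun_of_notMem_tsupport _ hw.2

theorem mulExtendFun_mem_smoothMaps (hh : ContMDiff I 𝓘(ℝ, ℝ) ∞ h) (hhU : tsupport h ⊆ U)
    (η : SmoothMap I U F) : mulExtendFun U h η ∈ smoothMaps I M F := by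
  refine ⟨continuous_mulExtendFun hh.continuous hhU η.2.1, fun φ hφ => ?_⟩
  by_cases hU : Nonempty U
  · exact isSmoothOn_mulExtendFun hU hh hhU η hφ
  · exact isSmoothOn_zero.congr fun z _ => dif_neg fun hz => hU ⟨_, hz⟩

/-- Multiplication of smooth maps on `U` with a smooth function `h` supported in `U`, followed by
extension by zero. -/
noncomputable def mulExtend (hh : ContMDiff I 𝓘(ℝ, ℝ) ∞ h) (hhU : tsupport h ⊆ U) :
    SmoothMap I U F →ₗ[ℝ] SmoothMap I M F where
  toFun η := (⟨mulExtendFun U h η, mulExtendFun_mem_smoothMaps hh hhU η⟩ : smoothMaps I M F)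
  map_add' η ζ := by
    refine DFunLike.ext _ _ fun x => ?_
    change mulExtendFun U h (η + ζ) x = mulExtendFun U h η x + mulExtendFun U h ζ x
    by_cases hx : x ∈ U
    · simp only [mulExtendFun_of_mem _ hx]
      exact smul_add _ _ _
    · simp [mulExtendFun, hx]
  map_smul' c η := by
    refine DFunLike.ext _ _ fun x => ?_
    change mulExtendFun U h (c • η) x = c • mulExtendFun U h η x
    by_cases hx : x ∈ U
    · simp only [mulExtendFun_of_mem _ hx]
      exact smul_comm _ _ _
    · simp [mulExtendFun, hx]

theorem continuous_mulExtend [FiniteDimensional ℝ E] (hh : ContMDiff I 𝓘(ℝ, ℝ) ∞ h)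
    (hhU : tsupport h ⊆ U) :
    Continuous (mulExtend hh hhU : SmoothMap I U F →ₗ[ℝ] SmoothMap I M F) := by
  by_cases hU : Nonempty U
  · exact continuous_of_continuousOn_extIterDirDeriv fun φ hφ k =>
      continuousOn_extIterDirDeriv_mulExtendFun hU hh hhU hφ k
  · refine continuous_const.congr (f := fun _ => 0) fun η => DFunLike.ext _ _ fun x => ?_
    have h1 : mulExtendFun U h η x = 0 := dif_neg fun hx => hU ⟨_, hx⟩
    exact h1.symm

end MulExtend

end SmoothMap

/-! ### The finest locally convex topology -/

section FinestLocallyConvex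

variable {X : Type*} [AddCommGroup X] [Module ℝ X] {κ : Type*} {Y : κ → Type*}
  [∀ k, TopologicalSpace (Y k)] (j : ∀ k, Y k → X)

theorem isTopologicalAddGroup_finestLocallyConvex :
    @IsTopologicalAddGroup X (finestLocallyConvex j) _ :=
  topologicalAddGroup_sInf fun _ ht => ht.1

theorem continuousSMul_finestLocallyConvex :
    @ContinuousSMul ℝ X _ _ (finestLocallyConvex j) :=
  continuousSMul_sInf fun _ ht => ht.2.1

theorem locallyConvexSpace_finestLocallyConvex :
    @LocallyConvexSpace ℝ X _ _ _ _ (finestLocallyConvex j) :=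
  LocallyConvexSpace.sInf fun _ ht => ht.2.2.1

theorem continuous_finestLocallyConvex (k : κ) :
    @Continuous (Y k) X _ (finestLocallyConvex j) (j k) :=
  continuous_sInf_rng.2 fun _ ht => ht.2.2.2 k

/-- The universal property of the finest locally convex topology: a linear map into a locally
convex space is continuous if its compositions with all the maps `j k` are. -/
theorem continuous_of_finestLocallyConvex {Z : Type*} [AddCommGroup Z] [Module ℝ Z]
    [TopologicalSpace Z] [IsTopologicalAddGroup Z] [ContinuousSMul ℝ Z] [LocallyConvexSpace ℝ Z]
    (f : X →ₗ[ℝ] Z) (hf : ∀ k, Continuous fun y => f (j k y)) :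
    @Continuous X Z (finestLocallyConvex j) _ f :=
  continuous_iff_le_induced.2 (sInf_le ⟨topologicalAddGroup_induced f, continuousSMul_induced f,
    LocallyConvexSpace.induced f, fun k => continuous_induced_rng.2 (hf k)⟩)

end FinestLocallyConvex

section DirectSum

variable {ι : Type*} {X : ι → Type*} [∀ i, AddCommGroup (X i)] [∀ i, Module ℝ (X i)]
  [∀ i, TopologicalSpace (X i)]

instance : IsTopologicalAddGroup (⨁ i, X i) := isTopologicalAddGroup_finestLocallyConvex _

instance : ContinuousSMul ℝ (⨁ i, X i) := continuousSMul_finestLocallyConvex _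

instance : LocallyConvexSpace ℝ (⨁ i, X i) := locallyConvexSpace_finestLocallyConvex _

open Classical in
theorem DirectSum.continuous_lof (i : ι) : Continuous (DirectSum.lof ℝ ι X i) :=
  continuous_finestLocallyConvex (fun i => (DirectSum.lof ℝ ι X i : X i → ⨁ i, X i)) i

variable {Z : Type*} [AddCommGroup Z] [Module ℝ Z] [TopologicalSpace Z] [IsTopologicalAddGroup Z]
  [ContinuousSMul ℝ Z] [LocallyConvexSpace ℝ Z]

open Classical in
theorem DirectSum.continuous_of_continuous_lof (f : (⨁ i, X i) →ₗ[ℝ] Z)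
    (hf : ∀ i, Continuous fun y => f (DirectSum.lof ℝ ι X i y)) : Continuous f :=
  continuous_of_finestLocallyConvex _ f hf

theorem DirectSum.continuous_comp_component (i : ι) (f : X i →ₗ[ℝ] Z) (hf : Continuous f) :
    Continuous (f ∘ₗ DirectSum.component ℝ ι X i) := by
  classical
  refine DirectSum.continuous_of_continuous_lof _ fun k => ?_
  by_cases hk : k = i
  · subst hk
    exact hf.congr fun y => by simp [DirectSum.component.lof_self]
  · refine continuous_const.congr (f := fun _ => 0) fun y => ?_
    simp only [LinearMap.comp_apply, DirectSum.component.of, dif_neg hk, map_zero]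

end DirectSum

/-! ### Compactly supported smooth maps -/

namespace SmoothMapC

variable {E : Type*} [NormedAddCommGroup E] [NormedSpace ℝ E]
  {H : Type*} [TopologicalSpace H] {I : ModelWithCorners ℝ E H}
  {M : Type*} [TopologicalSpace M] [ChartedSpace H M]
  {F : Type*} [AddCommGroup F] [Module ℝ F] [TopologicalSpace F]
  [IsTopologicalAddGroup F] [ContinuousSMul ℝ F] [T2Space F]

instance : IsTopologicalAddGroup (SmoothMapC I M F) := isTopologicalAddGroup_finestLocallyConvex _

instance : ContinuousSMul ℝ (SmoothMapC I M F) := continuousSMul_finestLocallyConvex _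

instance : LocallyConvexSpace ℝ (SmoothMapC I M F) := locallyConvexSpace_finestLocallyConvex _

theorem continuous_incl (K : Compacts M) : Continuous (incl I M F K) :=
  continuous_finestLocallyConvex (incl I M F) K

variable (I M F) in
/-- The inclusion `C^∞_c(M, F) → C^∞(M, F)`. -/
noncomputable def toSmoothMap : SmoothMapC I M F →ₗ[ℝ] SmoothMap I M F :=
  (compactlySupportedSmoothMaps I M F).subtype

variable (I M F) in
/-- Evaluation at a point, as a linear map. -/
noncomputable def evalAt (x : M) : SmoothMapC I M F →ₗ[ℝ] F where
  toFun γ := γ x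
  map_add' _ _ := rfl
  map_smul' _ _ := rfl

variable {ι : Type*} {V : ι → Opens M}

section Restrict

variable [IsManifold I ∞ M]

theorem restrict_eq_zero {γ : SmoothMap I M F} {K : Set M} (hγ : γ ∈ SmoothMap.supportedIn I M F K)
    {U : Opens M} (hU : ¬((U : Set M) ∩ K).Nonempty) : SmoothMap.restrict U γ = 0 :=
  DFunLike.ext _ _ fun x : U => hγ x fun hx => hU ⟨x, x.2, hx⟩

theorem finite_restrict_ne_zero (hV : LocallyFinite fun i => (V i : Set M))
    (γ : SmoothMapC I M F) :
    {i | SmoothMap.restrict (V i) (toSmoothMap I M F γ) ≠ 0}.Finite := by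
  obtain ⟨K, hK, hγ⟩ := γ.2
  exact (hV.finite_nonempty_inter_compact hK).subset fun i hi =>
    not_not.1 fun h => hi (restrict_eq_zero hγ h)

open Classical in
theorem mk_restrict_apply (hV : LocallyFinite fun i => (V i : Set M)) (γ : SmoothMapC I M F)
    (i : ι) :
    DirectSum.mk (fun i => SmoothMap I (V i) F) (finite_restrict_ne_zero hV γ).toFinset
      (fun i => SmoothMap.restrict (V i) (toSmoothMap I M F γ)) i =
      SmoothMap.restrict (V i) (toSmoothMap I M F γ) := by
  by_cases hi : i ∈ (finite_restrict_ne_zero hV γ).toFinset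
  · exact DirectSum.mk_apply_of_mem hi
  · rw [DirectSum.mk_apply_of_notMem hi]
    rw [Finite.mem_toFinset, Set.mem_ofPred_eq, not_not] at hi
    exact hi.symm

open Classical in
/-- The restriction map `C^∞_c(M, F) → ⨁ C^∞(V_i, F)` for a locally finite family `V` of open
sets. -/
noncomputable def restrictSum (hV : LocallyFinite fun i => (V i : Set M)) :
    SmoothMapC I M F →ₗ[ℝ] ⨁ i, SmoothMap I (V i) F where
  toFun γ := DirectSum.mk _ (finite_restrict_ne_zero hV γ).toFinset
    fun i => SmoothMap.restrict (V i) (toSmoothMap I M F γ)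
  map_add' γ δ := DFinsupp.ext fun i => by
    rw [DirectSum.add_apply, mk_restrict_apply hV, mk_restrict_apply hV, mk_restrict_apply hV,
      map_add, map_add]
  map_smul' c γ := DFinsupp.ext fun i => by
    rw [RingHom.id_apply, DirectSum.smul_apply, mk_restrict_apply hV, mk_restrict_apply hV,
      map_smul, map_smul]

theorem restrictSum_apply (hV : LocallyFinite fun i => (V i : Set M)) (γ : SmoothMapC I M F)
    (i : ι) : restrictSum hV γ i = SmoothMap.restrict (V i) (toSmoothMap I M F γ) :=
  mk_restrict_apply hV γ i

theorem continuous_restrictSum (hV : LocallyFinite fun i => (V i : Set M)) :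
    Continuous (restrictSum hV : SmoothMapC I M F →ₗ[ℝ] ⨁ i, SmoothMap I (V i) F) := by
  classical
  refine continuous_of_finestLocallyConvex _ _ fun K => ?_
  have h1 : Continuous fun γ : SmoothMap.supportedIn I M F (K : Set M) =>
      ∑ i ∈ (hV.finite_nonempty_inter_compact K.isCompact).toFinset,
        DirectSum.lof ℝ ι (fun i => SmoothMap I (V i) F) i (SmoothMap.restrict (V i) γ.1) :=
    continuous_finsetSum _ fun i _ => (DirectSum.continuous_lof i).comp
      ((SmoothMap.continuous_restrict (V i)).comp continuous_subtype_val)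
  refine h1.congr fun γ => DFinsupp.ext fun i => ?_
  refine Eq.trans ?_ (restrictSum_apply hV _ i).symm
  change DirectSum.component ℝ ι (fun i => SmoothMap I (V i) F) i _ = _
  rw [map_sum]
  simp only [DirectSum.component.of]
  by_cases hi : ((V i : Set M) ∩ K).Nonempty
  · rw [Finset.sum_eq_single i]
    · rw [dif_pos rfl]
      rfl
    · exact fun k _ hk => dif_neg hk
    · exact fun h => (h (by simpa using hi)).elim
  · rw [Finset.sum_eq_zero]
    · exact (restrict_eq_zero γ.2 hi).symm
    · intro k hk
      refine dif_neg ?_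
      rintro rfl
      exact hi (by simpa using hk)

theorem restrictSum_mem_gluedFamilies (hV : LocallyFinite fun i => (V i : Set M))
    (γ : SmoothMapC I M F) : restrictSum hV γ ∈ gluedFamilies I F V := by
  intro i k x hi hk
  rw [restrictSum_apply, restrictSum_apply]
  rfl

theorem isClosed_gluedFamilies [LocallyConvexSpace ℝ F] :
    IsClosed (gluedFamilies I F V : Set (⨁ i, SmoothMap I (V i) F)) := by
  have hc : ∀ (i : ι) (x : V i), Continuous fun η : ⨁ i, SmoothMap I (V i) F => η i x :=
    fun i x => DirectSum.continuous_comp_component (X := fun i => SmoothMap I (V i) F) i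
      ({ toFun := fun γ => γ x, map_add' := fun _ _ => rfl, map_smul' := fun _ _ => rfl } :
        SmoothMap I (V i) F →ₗ[ℝ] F) (SmoothMap.continuous_eval_const x)
  have h1 : (gluedFamilies I F V : Set (⨁ i, SmoothMap I (V i) F)) =
      ⋂ (i) (j) (x : M) (hi : x ∈ V i) (hj : x ∈ V j), {η | η i ⟨x, hi⟩ = η j ⟨x, hj⟩} := by
    ext η
    simp only [mem_iInter]
    rfl
  rw [h1]
  exact isClosed_iInter fun i => isClosed_iInter fun j => isClosed_iInter fun x =>
    isClosed_iInter fun hi => isClosed_iInter fun hj => isClosed_eq (hc i _) (hc j _)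

end Restrict

section Glue

/-- Multiplication of smooth maps on `U` with a smooth function compactly supported in `U`,
followed by extension by zero, as a map into the space of compactly supported smooth maps. -/
noncomputable def mulExtend {U : Opens M} {h : M → ℝ} (hh : ContMDiff I 𝓘(ℝ, ℝ) ∞ h)
    (hhU : tsupport h ⊆ U) (hc : HasCompactSupport h) : SmoothMap I U F →ₗ[ℝ] SmoothMapC I M F :=
  (SmoothMap.mulExtend hh hhU).codRestrict (compactlySupportedSmoothMaps I M F) fun _ =>
    ⟨tsupport h, hc, fun _ hx => SmoothMap.mulExtendFun_of_notMem_tsupport _ hx⟩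

theorem continuous_mulExtend [FiniteDimensional ℝ E] {U : Opens M} {h : M → ℝ}
    (hh : ContMDiff I 𝓘(ℝ, ℝ) ∞ h) (hhU : tsupport h ⊆ U) (hc : HasCompactSupport h) :
    Continuous (mulExtend hh hhU hc : SmoothMap I U F →ₗ[ℝ] SmoothMapC I M F) :=
  (continuous_incl ⟨tsupport h, hc⟩).comp ((SmoothMap.continuous_mulExtend hh hhU).subtype_mk
    fun _ _ hx => SmoothMap.mulExtendFun_of_notMem_tsupport _ hx)

variable {ρ : ι → M → ℝ} (hρ : ∀ i, ContMDiff I 𝓘(ℝ, ℝ) ∞ (ρ i)) (hρV : ∀ i, tsupport (ρ i) ⊆ V i)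
  (hρc : ∀ i, HasCompactSupport (ρ i))

open Classical in
/-- The map `(η_i) ↦ ∑ ρ_i • η_i` for compactly supported smooth functions `ρ_i` on `V_i`. -/
noncomputable def sumMulExtend : (⨁ i, SmoothMap I (V i) F) →ₗ[ℝ] SmoothMapC I M F :=
  DirectSum.toModule ℝ ι _ fun i => mulExtend (hρ i) (hρV i) (hρc i)

theorem continuous_sumMulExtend [FiniteDimensional ℝ E] :
    Continuous (sumMulExtend hρ hρV hρc : (⨁ i, SmoothMap I (V i) F) →ₗ[ℝ] SmoothMapC I M F) := by
  classical
  refine DirectSum.continuous_of_continuous_lof _ fun i => ?_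
  refine (continuous_mulExtend (hρ i) (hρV i) (hρc i)).congr fun y => ?_
  exact (DirectSum.toModule_lof ℝ (M := fun i => SmoothMap I (V i) F)
    (φ := fun i => mulExtend (hρ i) (hρV i) (hρc i)) i y).symm

open Classical in
theorem sumMulExtend_apply (η : ⨁ i, SmoothMap I (V i) F) (x : M) :
    sumMulExtend hρ hρV hρc η x =
      ∑ i ∈ DFinsupp.support η, SmoothMap.mulExtendFun (V i) (ρ i) (η i) x := by
  change evalAt I M F x _ = _
  conv_lhs => rw [← DirectSum.sum_support_of η]
  rw [map_sum, map_sum]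
  refine Finset.sum_congr rfl fun i _ => ?_
  exact congrArg (evalAt I M F x)
    (DirectSum.toModule_lof ℝ (M := fun i => SmoothMap I (V i) F) i (η i))

theorem sumMulExtend_apply_of_mem_gluedFamilies (h1 : ∀ x, ∑ᶠ i, ρ i x = 1)
    {η : ⨁ i, SmoothMap I (V i) F} (hη : η ∈ gluedFamilies I F V) (i : ι) (x : V i) :
    sumMulExtend hρ hρV hρc η x = η i x := by
  classical
  have hmem : ∀ {k}, ρ k x ≠ 0 → (x : M) ∈ V k := fun {k} hk =>
    hρV k (subset_tsupport _ hk)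
  have h2 : ∀ k, SmoothMap.mulExtendFun (V k) (ρ k) (η k) x = ρ k x • η i x := by
    intro k
    by_cases hk : (x : M) ∈ V k
    · rw [SmoothMap.mulExtendFun_of_mem _ hk, hη k i x hk x.2]
    · rw [not_not.1 (mt hmem hk), zero_smul]
      exact dif_neg hk
  rw [sumMulExtend_apply, Finset.sum_congr rfl fun k _ => h2 k,
    ← finsum_eq_sum_of_support_subset, ← finsum_smul, h1, one_smul]
  · intro k hk
    have h3 : ρ k x ≠ 0 := left_ne_zero_of_smul hk
    have h4 : η i x ≠ 0 := right_ne_zero_of_smul hk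
    rw [Finset.mem_coe, DFinsupp.mem_support_iff]
    intro h0
    refine h4 ?_
    rw [← hη k i x (hmem h3) x.2, h0]
    rfl

end Glue

end SmoothMapC

theorem mainTheorem7
    {E : Type*} [NormedAddCommGroup E] [NormedSpace ℝ E] [FiniteDimensional ℝ E]
    {H : Type*} [TopologicalSpace H] (I : ModelWithCorners ℝ E H)
    (M : Type*) [TopologicalSpace M] [ChartedSpace H M] [IsManifold I ∞ M]
    [T2Space M] [SigmaCompactSpace M]
    (F : Type*) [AddCommGroup F] [Module ℝ F] [TopologicalSpace F]
    [IsTopologicalAddGroup F] [ContinuousSMul ℝ F] [LocallyConvexSpace ℝ F] [T2Space F]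
    {ι : Type*} (V : ι → Opens M)
    (hV_compact : ∀ i, IsCompact (closure (V i : Set M)))
    (hV_finite : LocallyFinite fun i => (V i : Set M))
    (hV_cover : ⋃ i, (V i : Set M) = univ) :
    ∃ Φ : SmoothMapC I M F →ₗ[ℝ] ⨁ i, SmoothMap I (V i) F,
      (∀ (γ : SmoothMapC I M F) (i : ι) (x : V i), Φ γ i x = γ x) ∧
      IsEmbedding Φ ∧
      IsClosed (range Φ) ∧
      LinearMap.range Φ = gluedFamilies I F V ∧
      ∃ glue : gluedFamilies I F V →L[ℝ] SmoothMapC I M F,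
        (∀ (η : gluedFamilies I F V) (i : ι) (x : V i), glue η x = η.1 i x) ∧
        (∀ η : gluedFamilies I F V, Φ (glue η) = η) ∧
        (∀ (γ : SmoothMapC I M F) (hγ : Φ γ ∈ gluedFamilies I F V), glue ⟨Φ γ, hγ⟩ = γ) := by
  classical
  obtain ⟨ρ, hρV⟩ := SmoothPartitionOfUnity.exists_isSubordinate I isClosed_univ
    (fun i => (V i : Set M)) (fun i => (V i).2) hV_cover.ge
  have hρ : ∀ i, ContMDiff I 𝓘(ℝ, ℝ) ∞ (ρ i) := fun i => (ρ i).contMDiff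
  have hρc : ∀ i, HasCompactSupport (ρ i) := fun i =>
    (hV_compact i).of_isClosed_subset (isClosed_tsupport _) ((hρV i).trans subset_closure)
  have hsum : ∀ x, ∑ᶠ i, ρ i x = 1 := fun x => ρ.sum_eq_one (mem_univ x)
  let Φ := SmoothMapC.restrictSum (I := I) (F := F) hV_finite
  let P := SmoothMapC.sumMulExtend (I := I) (F := F) hρ hρV hρc
  have hP : Continuous P := SmoothMapC.continuous_sumMulExtend hρ hρV hρc
  have hΦ : ∀ (γ : SmoothMapC I M F) (i : ι) (x : V i), Φ γ i x = γ x := fun γ i x =>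
    DFunLike.congr_fun (SmoothMapC.restrictSum_apply hV_finite γ i) x
  have hglue : ∀ η ∈ gluedFamilies I F V, ∀ (i : ι) (x : V i), P η x = η i x := fun η hη i x =>
    SmoothMapC.sumMulExtend_apply_of_mem_gluedFamilies hρ hρV hρc hsum hη i x
  have hmem : ∀ γ, Φ γ ∈ gluedFamilies I F V :=
    SmoothMapC.restrictSum_mem_gluedFamilies hV_finite
  have hPΦ : ∀ γ, P (Φ γ) = γ := fun γ => DFunLike.ext _ _ fun x => by
    obtain ⟨i, hi⟩ := mem_iUnion.1 (hV_cover.ge (mem_univ x))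
    exact (hglue _ (hmem γ) i ⟨x, hi⟩).trans (hΦ γ i ⟨x, hi⟩)
  have hΦP : ∀ η ∈ gluedFamilies I F V, Φ (P η) = η := fun η hη => DFinsupp.ext fun i =>
    DFunLike.ext _ _ fun x => (hΦ _ i x).trans (hglue η hη i x)
  have hrange : LinearMap.range Φ = gluedFamilies I F V := by
    ext η
    refine ⟨?_, fun hη => ⟨P η, hΦP η hη⟩⟩
    rintro ⟨γ, rfl⟩
    exact hmem γ
  refine ⟨Φ, hΦ, Function.LeftInverse.isEmbedding hPΦ hP
    (SmoothMapC.continuous_restrictSum hV_finite), ?_, hrange,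
    ⟨P.domRestrict _, hP.comp continuous_subtype_val⟩, fun η => hglue η.1 η.2,
    fun η => hΦP η.1 η.2, fun γ _ => hPΦ γ⟩
  rw [← LinearMap.coe_range, hrange]
  exact SmoothMapC.isClosed_gluedFamilies
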